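/- **Theorem 4.5 (Symplectic leaves correspondence).** Let $(M,\{\cdot,\cdot\})$ be a smooth Poisson manifold (finite-dimensional, Hausdorff, second countable, without boundary), let $\mathcal P(M)$ be its group of Poisson diffeomorphisms, and let $A,B\subset\mathcal P(M)$ be subgroups. *Notation.* Let $\pi_A:M\to M/A$, $m\mapsto[m]_A$, be the projection onto the orbit space, with the quotient topology. For $f\in C^\infty(U)$, $U\subset M$ open, $X_f$ is the Hamiltonian vector field on $U$ with $X_f[g]=\{g,f\}$; the flow $F_t$ of a vector field on $U$ is defined on the set $\mathrm{Dom}(F_t)$ of the points of $U$ whose integral curve in $U$ exists at time $t$. Partial maps are composed on their natural domains. The *standard polar family* $\mathcal A'$ of $A$ is the set of all $X_f$ with $f\in C^\infty(U)$ $A$-invariant and $U\subset M$ open and $A$-invariant; the *polar distribution* $A'$ is the generalized distribution spanned by $\mathcal A'$; the *standard polar pseudogroup* $G_{\mathcal A'}$ consists of all finite compositions of flows of members of $\mathcal A'$. A partial map $F$ of $M$ *induces* the partial map $\bar F$ of $M/A$ if $\mathrm{Dom}(\bar F)=\pi_A(\mathrm{Dom}(F))$ and $\bar F\circ\pi_A=\pi_A\circ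 F$ on $\mathrm{Dom}(F)$. For $V\subset M/A$ open let $C^\infty(V)$ be the set of continuous $h:V\to\mathbb R$ with $h\circ\pi_A\in C^\infty(\pi_A^{-1}(V))$; the *Hamiltonian flows* of $h$ are the partial maps of $M/A$ induced by the flows of $X_{h\circ\pi_A}$ on $\pi_A^{-1}(V)$. The *symplectic leaf* $\mathcal L_{[m]_A}$ is the set of all points of $M/A$ that can be reached from $[m]_A$ by finitely many Hamiltonian flows of functions $h\in C^\infty(V)$, $V\subset M/A$ open. The same notation is used for $B$. The diagram $M/A\xleftarrow{\pi_A}M\xrightarrow{\pi_B}M/B$ is a *dual pair* if the generalized distributions $A'$ and $B'$ are integrable (there is a maximal integral submanifold, or leaf, through every point), the leaves of $A'$ are exactly the $B$-orbits in $M$, and the leaves of $B'$ are exactly the $A$-orbits in $M$. *Claim.* (i) Every $F\in G_{\mathcal A'}$ induces a unique partial map of $M/A$, so that $G_{\mathcal A'}$ acts on $M/A$. Lying in the same symplectic leaf is an equivalence relation on $M/A$, and for each $m\in M$ the symplectic leaf $\mathcal L_{[m]_A}$ is the orbit of $[m]_A$ under this action. Consequently the space $(M/A)/\{\cdot,\cdot\}_{M/A}$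 of symplectic leaves equals the orbit space $(M/A)/G_{\mathcal A'}$. The same holds with $B$ in place of $A$; in particular $(M/B)/\{\cdot,\cdot\}_{M/B}=(M/B)/G_{\mathcal B'}$. (ii) If $M/A\xleftarrow{\pi_A}M\xrightarrow{\pi_B}M/B$ is a dual pair, then $$(M/A)/\{\cdot,\cdot\}_{M/A}\longrightarrow(M/B)/\{\cdot,\cdot\}_{M/B},\qquad \mathcal L_{[m]_A}\longmapsto\mathcal L_{[m]_B}\qquad(m\in M),$$ is a well-defined bijection. -/

import Mathlib

open Set Filter Topology
open scoped Manifold ContDiff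

noncomputable section

namespace SingularDual

universe u v

variable {E : Type v} [NormedAddCommGroup E] [NormedSpace ℝ E]
variable {M : Type u} [TopologicalSpace M] [ChartedSpace E M]

/-! ### Diffeomorphism groups -/

variable (E M) in
/-- The smooth diffeomorphisms of `M`. -/
abbrev Diff : Type u := M ≃ₘ⟮𝓘(ℝ, E), 𝓘(ℝ, E)⟯ M

/-- `Diff(M)` is a group under composition: `(φ * ψ) x = φ (ψ x)`. -/
instance instGroupDiff : Group (Diff E M) where
  mul φ ψ := Diffeomorph.trans ψ φ
  one := Diffeomorph.refl 𝓘(ℝ, E) M ∞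
  inv φ := Diffeomorph.symm φ
  mul_assoc _ _ _ := rfl
  one_mul _ := rfl
  mul_one _ := rfl
  inv_mul_cancel φ := Diffeomorph.ext fun x => φ.symm_apply_apply x

/-- The tautological action of `Diff(M)` on `M`. -/
instance instMulActionDiff : MulAction (Diff E M) M where
  smul φ x := φ x
  one_smul _ := rfl
  mul_smul _ _ _ := rfl

/-! ### Poisson manifolds -/

variable (E M) in
/-- The algebra `C^∞(M)` of smooth real functions. -/
abbrev SmoothFun : Type u := C^∞⟮𝓘(ℝ, E), M; 𝓘(ℝ, ℝ), ℝ⟯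

variable (E M) in
/-- A Poisson structure on `M`: a Lie bracket on `C^∞(M)` that is a derivation in each argument. -/
structure PoissonStructure where
  bracket : SmoothFun E M →ₗ[ℝ] SmoothFun E M →ₗ[ℝ] SmoothFun E M
  skew : ∀ f g, bracket f g = - bracket g f
  jacobi : ∀ f g h,
    bracket f (bracket g h) + bracket g (bracket h f) + bracket h (bracket f g) = 0
  leibniz : ∀ f g h, bracket (f * g) h = f * bracket g h + g * bracket f h

/-- The group `𝒫(M)` of Poisson automorphisms: the diffeomorphisms `φ` with
`{f ∘ φ, g ∘ φ} = {f, g} ∘ φ` for all `f, g ∈ C^∞(M)`. -/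
def PoissonStructure.aut (P : PoissonStructure E M) : Subgroup (Diff E M) where
  carrier := {φ | ∀ f g : SmoothFun E M,
    P.bracket (f.comp φ.toContMDiffMap) (g.comp φ.toContMDiffMap)
      = (P.bracket f g).comp φ.toContMDiffMap}
  one_mem' := fun _ _ => rfl
  mul_mem' := by
    intro φ ψ hφ hψ f g
    have h1 := hψ (f.comp φ.toContMDiffMap) (g.comp φ.toContMDiffMap)
    rw [hφ f g] at h1
    exact h1
  inv_mem' := by
    intro φ hφ f g
    have key : ∀ k : SmoothFun E M,
        (k.comp (φ⁻¹ : Diff E M).toContMDiffMap).comp φ.toContMDiffMap = k := by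
      intro k
      ext x
      exact congrArg k (φ.symm_apply_apply x)
    have key' : ∀ k : SmoothFun E M,
        (k.comp φ.toContMDiffMap).comp (φ⁻¹ : Diff E M).toContMDiffMap = k := by
      intro k
      ext x
      exact congrArg k (φ.apply_symm_apply x)
    have h1 := hφ (f.comp (φ⁻¹ : Diff E M).toContMDiffMap)
      (g.comp (φ⁻¹ : Diff E M).toContMDiffMap)
    rw [key f, key g] at h1
    rw [h1, key']

/-! ### Local vector fields and their flows -/

variable (E M) in
/-- A smooth vector field defined on an open subset `dom` of `M`; the values of `field` outside
`dom` are irrelevant. -/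
structure LocalVectorField [IsManifold 𝓘(ℝ, E) ∞ M] where
  dom : Set M
  isOpen_dom : IsOpen dom
  field : ∀ x : M, TangentSpace 𝓘(ℝ, E) x
  smooth : ContMDiffOn 𝓘(ℝ, E) 𝓘(ℝ, E).tangent ∞
    (fun x => (⟨x, field x⟩ : TangentBundle 𝓘(ℝ, E) M)) dom

section Flows

variable [IsManifold 𝓘(ℝ, E) ∞ M]

/-- `y` is the value at time `t` of an integral curve of `X` inside `dom X` that starts at `x` and
is defined on an open interval containing `0` and `t`. -/
def LocalVectorField.FlowsTo (X : LocalVectorField E M) (t : ℝ) (x y : M) : Prop :=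
  ∃ (γ : ℝ → M) (a b : ℝ), (0 : ℝ) ∈ Ioo a b ∧ t ∈ Ioo a b ∧
    (∀ s ∈ Ioo a b, γ s ∈ X.dom) ∧ IsMIntegralCurveOn γ X.field (Ioo a b) ∧
    γ 0 = x ∧ γ t = y

/-- The time `t` flow `(F_t, Dom(F_t))` of `X`, a partial map of `M`: `x ∈ Dom(F_t)` iff the
integral curve of `X` starting at `x` exists at time `t`, and `F_t x` is then its value (which
is unique on a Hausdorff manifold). -/
def LocalVectorField.flow (X : LocalVectorField E M) (t : ℝ) : M →. M := fun x =>
  ⟨∃ y, X.FlowsTo t x y, fun h => h.choose⟩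

/-- The composition `F₁ ∘ F₂ ∘ ⋯ ∘ Fₖ` of a list of partial maps, on its natural domain (the
empty composition is the identity). -/
def composeList {α : Type*} (L : List (α →. α)) : α →. α :=
  L.foldr PFun.comp (PFun.id α)

/-- The pseudogroup generated by a family `𝒟` of local vector fields: all the finite
compositions of (time `t`) flows of members of `𝒟`. -/
def generatedPseudogroup (𝒟 : Set (LocalVectorField E M)) : Set (M →. M) :=
  {F | ∃ L : List (M →. M), (∀ G ∈ L, ∃ X ∈ 𝒟, ∃ t : ℝ, G = X.flow t) ∧ F = composeList L}

/-! ### Generalized distributions -/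

/-- The generalized distribution spanned by a family of local vector fields. -/
def spannedDistribution (𝒟 : Set (LocalVectorField E M)) (x : M) :
    Submodule ℝ (TangentSpace 𝓘(ℝ, E) x) :=
  Submodule.span ℝ {w | ∃ X ∈ 𝒟, x ∈ X.dom ∧ w = X.field x}

/-- `S ⊆ M` is (the underlying set of) a connected immersed submanifold of `M`, in general not with
the subspace topology, which is an integral submanifold of `D` of maximal dimension at all of its
points: it is the image of an injective immersion `i : N → M` of a connected manifold with
`T_z i (T_z N) = D (i z)` for all `z`. -/
def IsIntegralSubmanifold (D : ∀ x : M, Submodule ℝ (TangentSpace 𝓘(ℝ, E) x)) (S : Set M) :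
    Prop :=
  ∃ (k : ℕ) (N : Type u) (_ : TopologicalSpace N) (_ : ChartedSpace (EuclideanSpace ℝ (Fin k)) N)
    (_ : IsManifold (𝓡 k) ∞ N) (_ : ConnectedSpace N) (i : N → M),
    Manifold.IsImmersion (𝓡 k) 𝓘(ℝ, E) ∞ i ∧ Function.Injective i ∧ range i = S ∧
    ∀ z : N, LinearMap.range (mfderiv (𝓡 k) 𝓘(ℝ, E) i z).toLinearMap = D (i z)

/-- `S` is a leaf of `D`: a maximal integral submanifold. -/
def IsLeaf (D : ∀ x : M, Submodule ℝ (TangentSpace 𝓘(ℝ, E) x)) (S : Set M) : Prop :=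
  IsIntegralSubmanifold D S ∧ ∀ S', IsIntegralSubmanifold D S' → S ⊆ S' → S' = S

/-- `D` is integrable: there is a maximal integral submanifold through every point. -/
def IsIntegrable (D : ∀ x : M, Submodule ℝ (TangentSpace 𝓘(ℝ, E) x)) : Prop :=
  ∀ x : M, ∃ S, IsLeaf D S ∧ x ∈ S

/-! ### Hamiltonian vector fields, polarity and dual pairs -/

/-- `X` is the Hamiltonian vector field `X_f` of the smooth function `f` on the open set `dom X`,
i.e. `X_f[g] = {g, f}`. Since `f` is only defined on `dom X`, the bracket is computed at each
`x ∈ dom X` with any global smooth function `F` with the same germ as `f` at `x`. -/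
def PoissonStructure.IsHamiltonian (P : PoissonStructure E M) (f : M → ℝ)
    (X : LocalVectorField E M) : Prop :=
  ∀ x ∈ X.dom, ∀ F g : SmoothFun E M, (F : M → ℝ) =ᶠ[𝓝 x] f →
    (mfderiv 𝓘(ℝ, E) 𝓘(ℝ, ℝ) (g : M → ℝ) x (X.field x) : ℝ) = P.bracket g F x

variable (P : PoissonStructure E M) (A B : Subgroup P.aut)

/-- The standard polar family of `A`: the Hamiltonian vector fields `X_f` of the `A`-invariant
smooth functions `f ∈ C^∞(U)^A` on `A`-invariant open sets `U ⊆ M`. -/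
def polarFamily : Set (LocalVectorField E M) :=
  {X | (∀ a : A, ∀ x ∈ X.dom, a • x ∈ X.dom) ∧
    ∃ f : M → ℝ, ContMDiffOn 𝓘(ℝ, E) 𝓘(ℝ, ℝ) ∞ f X.dom ∧
      (∀ a : A, ∀ x ∈ X.dom, f (a • x) = f x) ∧ P.IsHamiltonian f X}

/-- The polar distribution of `A`. -/
def polarDistribution : ∀ x : M, Submodule ℝ (TangentSpace 𝓘(ℝ, E) x) :=
  spannedDistribution (polarFamily P A)

/-- The standard polar pseudogroup of `A`. -/
def polarPseudogroup : Set (M →. M) :=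
  generatedPseudogroup (polarFamily P A)

/-- `M/A ← M → M/B` is a dual pair: the polar distributions of `A` and `B` are integrable, the
leaves of the first are the `B`-orbits, and the leaves of the second are the `A`-orbits. -/
structure IsDualPair : Prop where
  integrable_left : IsIntegrable (polarDistribution P A)
  integrable_right : IsIntegrable (polarDistribution P B)
  leaves_left : {S | IsLeaf (polarDistribution P A) S} = range fun m : M => MulAction.orbit B m
  leaves_right : {S | IsLeaf (polarDistribution P B) S} = range fun m : M => MulAction.orbit A m

/-! ### The quotient `M/A` and its symplectic leaves -/

/-- The orbit space `M/A`, with the quotient topology. -/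
abbrev OrbitSpace : Type u := Quotient (MulAction.orbitRel A M)

/-- The projection `π_A : M → M/A`. -/
def proj (m : M) : OrbitSpace P A := Quotient.mk (MulAction.orbitRel A M) m

/-- The partial map `F` of `M` projects to the partial map `Fbar` of `M/A`:
`Dom(Fbar) = π_A(Dom(F))` and `Fbar ∘ π_A = π_A ∘ F` on `Dom(F)`. -/
def Induces (F : M →. M) (Fbar : OrbitSpace P A →. OrbitSpace P A) : Prop :=
  Fbar.Dom = proj P A '' F.Dom ∧ ∀ x y : M, y ∈ F x → proj P A y ∈ Fbar (proj P A x)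

/-- The Hamiltonian flows of `M/A`: the projections of the flows of the Hamiltonian vector fields
`X_{h ∘ π_A}` on `π_A⁻¹(V)`, for the smooth functions `h ∈ C^∞(V)` on the open sets `V ⊆ M/A`. -/
def hamiltonianFlows : Set (OrbitSpace P A →. OrbitSpace P A) :=
  {Fbar | ∃ (V : Set (OrbitSpace P A)) (h : OrbitSpace P A → ℝ) (X : LocalVectorField E M) (t : ℝ),
    IsOpen V ∧ ContinuousOn h V ∧
    ContMDiffOn 𝓘(ℝ, E) 𝓘(ℝ, ℝ) ∞ (h ∘ proj P A) (proj P A ⁻¹' V) ∧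
    X.dom = proj P A ⁻¹' V ∧ P.IsHamiltonian (h ∘ proj P A) X ∧ Induces P A (X.flow t) Fbar}

/-- The symplectic leaf `ℒ_p` of `M/A` through `p`: the points that can be reached from `p` by
finitely many Hamiltonian flows. -/
def symplecticLeaf (p : OrbitSpace P A) : Set (OrbitSpace P A) :=
  {q | ∃ L : List (OrbitSpace P A →. OrbitSpace P A),
    (∀ G ∈ L, G ∈ hamiltonianFlows P A) ∧ q ∈ composeList L p}

/-- The space of symplectic leaves of `M/A`. -/
def leafSpace : Set (Set (OrbitSpace P A)) :=
  range (symplecticLeaf P A)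

/-- The orbit of `p ∈ M/A` under the standard polar pseudogroup of `A`, whose element `F` acts on
`M/A` through the partial map that it induces. -/
def polarOrbit (p : OrbitSpace P A) : Set (OrbitSpace P A) :=
  {q | ∃ F ∈ polarPseudogroup P A, ∃ Fbar, Induces P A F Fbar ∧ q ∈ Fbar p}

/-- The orbit space `(M/A)/G_{𝒜'}` of that action. -/
def polarOrbitSpace : Set (Set (OrbitSpace P A)) :=
  range (polarOrbit P A)

end Flows

end SingularDual

end

/-!
Everything on an orbit space is read off from the flows of the polar family on `M`. A Hamiltonian
vector field `X_f` of an `A`-invariant function on an `A`-invariant open set is itself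
`A`-invariant: the elements of `A` preserve the bracket, and a tangent vector is determined by the
derivatives of global smooth functions (`field_smul_of_mem_polarFamily`). Hence flows of the polar
family commute with `A` and induce partial maps of `M/A`. The `A`-invariant functions on
`A`-invariant open sets are exactly the functions on open subsets of `M/A`, so the Hamiltonian flows
of `M/A` are exactly the partial maps induced by flows of the polar family
(`mem_hamiltonianFlows_iff`). Both a symplectic leaf and an orbit of the polar pseudogroup are
therefore the projection of the set of points of `M` reachable by these flows, where equivariance
allows the pieces of a path in `M/A` to be lifted one after the other (`mem_symplecticLeaf_iff`,
`mem_polarOrbit_iff`).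

The correspondence of leaves rests on two facts about a dual pair. Flows of the polar family of `A`
stay inside the `B`-orbits, because these are integral submanifolds of a distribution to which the
fields are tangent and they partition `M` (`LocalVectorField.FlowsTo.mem_of_partition`). Conversely,
two points of the same `A`-orbit are joined by flows of the polar family of `B`, because that orbit
is a connected integral submanifold of the distribution spanned by this family
(`IsIntegralSubmanifold.reachable`). If now `a • m'` is reached from `m` by flows of the polar
family of `A`, then `a • m' = b • m` for some `b`, and `m'`, being in the `A`-orbit of `b • m`, is
reached from `b • m` by flows of the polar family of `B`. So `m` and `m'` also lie over the same
symplectic leaf of `M/B`, and the situation is symmetric in `A` and `B`.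

The joining of points in an integral submanifold is a local matter. In a slice (`Slice`) the fields
become vector fields on a Euclidean space which span it at the given point, and a composition of
their flows, as a function of the times, covers a neighbourhood of this point by the inverse
function theorem. Smooth dependence of flows on initial values is not needed for this: strict
differentiability of the flow at time `0` follows from the mean value inequality
(`exists_localFlow_hasStrictFDerivAt`).
-/

noncomputable section

namespace SingularDual

universe u v

/-! ### Local flows on normed spaces -/

/-- A `C¹` vector field has a local flow `(t, u) ↦ φ u t` which stays in a prescribed neighbourhood
and is strictly differentiable at `(0, u₀)`. Only the Lipschitz estimate of the Picard-Lindelöf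
theorem is used; strictness is what the inverse function theorem requires. -/
theorem exists_localFlow_hasStrictFDerivAt {F : Type*} [NormedAddCommGroup F] [NormedSpace ℝ F]
    [CompleteSpace F] {Y : F → F} {u₀ : F} (hY : ContDiffAt ℝ 1 Y u₀) {O : Set F}
    (hO : O ∈ 𝓝 u₀) :
    ∃ (φ : F → ℝ → F) (ε : ℝ), 0 < ε ∧
      (∀ᶠ u in 𝓝 u₀, φ u 0 = u ∧
        ∀ t ∈ Ioo (-ε) ε, HasDerivAt (φ u) (Y (φ u t)) t ∧ φ u t ∈ O) ∧
      HasStrictFDerivAt (fun p : ℝ × F => φ p.2 p.1)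
        (ContinuousLinearMap.snd ℝ ℝ F + (ContinuousLinearMap.fst ℝ ℝ F).smulRight (Y u₀))
        (0, u₀) := by
  obtain ⟨ε, hε, a, r, L, K, hr, hPL⟩ := IsPicardLindelof.of_contDiffAt_one hY
  obtain ⟨φ, hφ, L', hL'⟩ :=
    (hPL 0).exists_forall_mem_closedBall_eq_hasDerivWithinAt_lipschitzOnWith
  simp only [zero_sub, zero_add] at hφ hL'
  obtain ⟨K, s, hs, hK⟩ := hY.exists_lipschitzOnWith
  have hr' : (0 : ℝ) < r := hr
  have hu₀ : u₀ ∈ Metric.closedBall u₀ (r : ℝ) := Metric.mem_closedBall_self hr'.le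
  have hball : Metric.closedBall u₀ (r : ℝ) ∈ 𝓝 u₀ := Metric.closedBall_mem_nhds _ hr'
  have hderiv : ∀ u ∈ Metric.closedBall u₀ (r : ℝ), ∀ t ∈ Ioo (-ε) ε,
      HasDerivAt (φ u) (Y (φ u t)) t := fun u hu t ht =>
    ((hφ u hu).2 t (Ioo_subset_Icc_self ht)).hasDerivAt (Icc_mem_nhds ht.1 ht.2)
  have hcont : Tendsto (fun p : ℝ × F => φ p.2 p.1) (𝓝 (0, u₀)) (𝓝 u₀) := by
    have h0 : Tendsto (fun p : ℝ × F => (L' : ℝ) * ‖p.2 - u₀‖ + ‖φ u₀ p.1 - u₀‖)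
        (𝓝 (0, u₀)) (𝓝 0) := by
      have h1 : ContinuousAt (φ u₀) 0 := (hderiv u₀ hu₀ 0 (by simp [hε])).continuousAt
      have h2 : ContinuousAt (fun p : ℝ × F => φ u₀ p.1) (0, u₀) :=
        ContinuousAt.comp (f := fun p : ℝ × F => p.1) (x := ((0 : ℝ), u₀)) h1 continuousAt_fst
      have h3 : ContinuousAt (fun p : ℝ × F => (L' : ℝ) * ‖p.2 - u₀‖ + ‖φ u₀ p.1 - u₀‖)
        (0, u₀) := by fun_prop
      have := h3.tendsto
      simpa [(hφ u₀ hu₀).1] using this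
    rw [tendsto_iff_norm_sub_tendsto_zero]
    refine squeeze_zero' (Eventually.of_forall fun _ => norm_nonneg _) ?_ h0
    have e1 : ∀ᶠ p : ℝ × F in 𝓝 (0, u₀), p.1 ∈ Ioo (-ε) ε :=
      continuousAt_fst.eventually_mem (Ioo_mem_nhds (by simpa) (by simpa))
    have e2 : ∀ᶠ p : ℝ × F in 𝓝 (0, u₀), p.2 ∈ Metric.closedBall u₀ (r : ℝ) :=
      continuousAt_snd.eventually_mem hball
    filter_upwards [e1, e2] with p h1 h2
    have := (hL' p.1 (Ioo_subset_Icc_self h1)).dist_le_mul p.2 h2 u₀ hu₀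
    rw [dist_eq_norm, dist_eq_norm] at this
    calc ‖φ p.2 p.1 - u₀‖ = ‖(φ p.2 p.1 - φ u₀ p.1) + (φ u₀ p.1 - u₀)‖ := by congr 1; abel
      _ ≤ _ := (norm_add_le _ _).trans (by gcongr)
  -- On a small box the flow exists and stays in any prescribed neighbourhood of `u₀`.
  have hbox : ∀ W ∈ 𝓝 u₀, ∃ δ > 0, δ ≤ ε ∧ ∀ u, ‖u - u₀‖ < δ → u ∈ Metric.closedBall u₀ (r : ℝ) ∧
      ∀ t ∈ Ioo (-δ) δ, φ u t ∈ W := by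
    intro W hW
    obtain ⟨δ, hδ, h⟩ := Metric.mem_nhds_iff.1 (hcont hW)
    refine ⟨min δ (min ε r), by positivity, (min_le_right _ _).trans (min_le_left _ _),
      fun u hu => ⟨?_, fun t ht => ?_⟩⟩
    · rw [mem_closedBall_iff_norm]
      exact hu.le.trans ((min_le_right _ _).trans (min_le_right _ _))
    · refine h (a := (t, u)) ?_
      rw [Metric.mem_ball, Prod.dist_eq, max_lt_iff, dist_eq_norm, dist_eq_norm, sub_zero,
        Real.norm_eq_abs, abs_lt]
      have := min_le_left δ (min ε r)
      exact ⟨⟨by linarith [ht.1], by linarith [ht.2]⟩, hu.trans_le this⟩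
  obtain ⟨δ, hδ, hδε, hδO⟩ := hbox O hO
  refine ⟨φ, δ, hδ, ?_, ?_⟩
  · filter_upwards [Metric.ball_mem_nhds u₀ hδ] with u hu
    rw [mem_ball_iff_norm] at hu
    obtain ⟨h1, h2⟩ := hδO u hu
    refine ⟨(hφ u h1).1, fun t ht => ⟨hderiv u h1 t ⟨?_, ?_⟩, h2 t ht⟩⟩
    · linarith [ht.1]
    · linarith [ht.2]
  · rw [hasStrictFDerivAt_iff_isLittleO, Asymptotics.isLittleO_iff]
    intro c hc
    obtain ⟨δ₁, hδ₁, hδ₁ε, hδ₁s⟩ := hbox (s ∩ {u | ‖Y u - Y u₀‖ ≤ c / 2})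
      (inter_mem hs (by
        have h1 : Tendsto (fun u => ‖Y u - Y u₀‖) (𝓝 u₀) (𝓝 0) := by
          have : ContinuousAt (fun u => ‖Y u - Y u₀‖) u₀ := by
            have := hY.continuousAt
            fun_prop
          simpa using this.tendsto
        exact h1.eventually (Iic_mem_nhds (by positivity))))
    set C : ℝ := K * L' with hC
    have hC0 : 0 ≤ C := by positivity
    have hpos : 0 < min δ₁ (c / (2 * (C + 1))) := by positivity
    have e1 : ∀ᶠ p : (ℝ × F) × (ℝ × F) in 𝓝 ((0, u₀), (0, u₀)),
        |p.1.1| < min δ₁ (c / (2 * (C + 1))) ∧ |p.2.1| < δ₁ ∧ ‖p.1.2 - u₀‖ < δ₁ ∧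
          ‖p.2.2 - u₀‖ < δ₁ := by
      have t1 : ContinuousAt (fun p : (ℝ × F) × (ℝ × F) => |p.1.1|) ((0, u₀), (0, u₀)) := by
        fun_prop
      have t2 : ContinuousAt (fun p : (ℝ × F) × (ℝ × F) => |p.2.1|) ((0, u₀), (0, u₀)) := by
        fun_prop
      have t3 : ContinuousAt (fun p : (ℝ × F) × (ℝ × F) => ‖p.1.2 - u₀‖)
        ((0, u₀), (0, u₀)) := by fun_prop
      have t4 : ContinuousAt (fun p : (ℝ × F) × (ℝ × F) => ‖p.2.2 - u₀‖)
        ((0, u₀), (0, u₀)) := by fun_prop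
      exact (t1.eventually (gt_mem_nhds (by simpa using hpos))).and
        ((t2.eventually (gt_mem_nhds (by simpa using hδ₁))).and
        ((t3.eventually (gt_mem_nhds (by simpa using hδ₁))).and
        (t4.eventually (gt_mem_nhds (by simpa using hδ₁)))))
    filter_upwards [e1]
    rintro ⟨⟨t, x⟩, ⟨s', y⟩⟩ ⟨ht, hs', hx, hy⟩
    simp only at ht hs' hx hy
    obtain ⟨hxr, hxt⟩ := hδ₁s x hx
    obtain ⟨hyr, hyt⟩ := hδ₁s y hy
    have ht1 : t ∈ Ioo (-δ₁) δ₁ := abs_lt.1 (ht.trans_le (min_le_left _ _))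
    have hs1 : s' ∈ Ioo (-δ₁) δ₁ := abs_lt.1 hs'
    have h01 : (0 : ℝ) ∈ Ioo (-δ₁) δ₁ := by simp [hδ₁]
    have hsub : Ioo (-δ₁) δ₁ ⊆ Ioo (-ε) ε := Ioo_subset_Ioo (by linarith) hδ₁ε
    -- Two orbits drift apart at a rate controlled by the Lipschitz constants.
    have hfirst : ‖(φ x t - φ y t) - (φ x 0 - φ y 0)‖ ≤ C * ‖x - y‖ * ‖t - 0‖ := by
      refine Convex.norm_image_sub_le_of_norm_hasDerivWithin_le
        (f := fun τ => φ x τ - φ y τ) (s := Ioo (-δ₁) δ₁)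
        (f' := fun τ => Y (φ x τ) - Y (φ y τ)) (fun τ hτ => ?_) (fun τ hτ => ?_)
        (convex_Ioo _ _) h01 ht1
      · exact ((hderiv x hxr τ (hsub hτ)).sub (hderiv y hyr τ (hsub hτ))).hasDerivWithinAt
      · have k1 := hK.dist_le_mul _ (hxt τ hτ).1 _ (hyt τ hτ).1
        have k2 := (hL' τ (Ioo_subset_Icc_self (hsub hτ))).dist_le_mul x hxr y hyr
        rw [dist_eq_norm, dist_eq_norm] at k1 k2
        rw [hC, mul_assoc]
        exact k1.trans (by gcongr)
    -- Along a single orbit the velocity is almost `Y u₀`.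
    have hsecond : ‖(φ y t - t • Y u₀) - (φ y s' - s' • Y u₀)‖ ≤ c / 2 * ‖t - s'‖ := by
      refine Convex.norm_image_sub_le_of_norm_hasDerivWithin_le
        (f := fun τ => φ y τ - τ • Y u₀) (s := Ioo (-δ₁) δ₁)
        (f' := fun τ => Y (φ y τ) - Y u₀) (fun τ hτ => ?_) (fun τ hτ => (hyt τ hτ).2)
        (convex_Ioo _ _) hs1 ht1
      have := (hderiv y hyr τ (hsub hτ)).sub ((hasDerivAt_id τ).smul_const (Y u₀))
      simp only [one_smul] at this
      exact this.hasDerivWithinAt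
    rw [(hφ x hxr).1, (hφ y hyr).1, sub_zero, Real.norm_eq_abs] at hfirst
    have hCt : C * |t| ≤ c / 2 := by
      have h1 : |t| ≤ c / (2 * (C + 1)) := (ht.trans_le (min_le_right _ _)).le
      calc C * |t| ≤ (C + 1) * (c / (2 * (C + 1))) := by gcongr; linarith
        _ = c / 2 := by field_simp
    have hn1 : ‖x - y‖ ≤ ‖((t, x) : ℝ × F) - (s', y)‖ := norm_snd_le (((t, x) : ℝ × F) - (s', y))
    have hn2 : ‖t - s'‖ ≤ ‖((t, x) : ℝ × F) - (s', y)‖ := norm_fst_le (((t, x) : ℝ × F) - (s', y))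
    have heq : φ x t - φ y s' - (ContinuousLinearMap.snd ℝ ℝ F +
        (ContinuousLinearMap.fst ℝ ℝ F).smulRight (Y u₀)) ((t, x) - (s', y)) =
        ((φ x t - φ y t) - (x - y)) + ((φ y t - t • Y u₀) - (φ y s' - s' • Y u₀)) := by
      simp only [Prod.mk_sub_mk, add_apply, ContinuousLinearMap.coe_snd',
        ContinuousLinearMap.smulRight_apply, ContinuousLinearMap.coe_fst', sub_smul]
      abel
    rw [heq]
    calc _ ≤ C * ‖x - y‖ * |t| + c / 2 * ‖t - s'‖ := (norm_add_le _ _).trans (by gcongr)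
      _ = C * |t| * ‖x - y‖ + c / 2 * ‖t - s'‖ := by ring
      _ ≤ c / 2 * ‖((t, x) : ℝ × F) - (s', y)‖ + c / 2 * ‖((t, x) : ℝ × F) - (s', y)‖ := by
        gcongr
      _ = c * ‖((t, x) : ℝ × F) - (s', y)‖ := by ring

/-- If vector fields span the space at `u₀`, then all points near `u₀` can be reached from `u₀` along
their short integral curves. The relation `R` stands for reachability; it is kept abstract so that
it can be a relation between points of a manifold parametrized by `F`. -/
theorem eventually_reachable_of_span_eq_top {F : Type*} [NormedAddCommGroup F] [NormedSpace ℝ F]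
    [FiniteDimensional ℝ F] {u₀ : F} {𝒴 : Set (F → F)} (h𝒴 : ∀ Y ∈ 𝒴, ContDiffAt ℝ 1 Y u₀)
    (hspan : Submodule.span ℝ {w | ∃ Y ∈ 𝒴, w = Y u₀} = ⊤)
    {R : F → F → Prop} (hrefl : ∀ u, R u u) (htrans : ∀ u v w, R u v → R v w → R u w)
    (hR : ∀ Y ∈ 𝒴, ∃ O ∈ 𝓝 u₀, ∀ (c : ℝ → F) (ε : ℝ), 0 < ε →
      (∀ t ∈ Ioo (-ε) ε, HasDerivAt c (Y (c t)) t ∧ c t ∈ O) → ∀ t ∈ Ioo (-ε) ε, R (c 0) (c t)) :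
    ∀ᶠ u in 𝓝 u₀, R u₀ u := by
  classical
  have : CompleteSpace F := FiniteDimensional.complete ℝ F
  obtain ⟨T, hT, hTspan⟩ := (Submodule.fg_span_iff_fg_span_finset_subset _).1
    (hspan ▸ Module.Finite.fg_top :
      (Submodule.span ℝ {w | ∃ Y ∈ 𝒴, w = Y u₀}).FG)
  -- `Φ` composes the flows of the fields belonging to `T`; its domain `V` is a product of time axes.
  have key : ∀ T : Finset F, ↑T ⊆ {w | ∃ Y ∈ 𝒴, w = Y u₀} →
      ∃ (V : Type) (_ : NormedAddCommGroup V) (_ : NormedSpace ℝ V) (_ : CompleteSpace V)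
        (Φ : V → F) (Φ' : V →L[ℝ] F), HasStrictFDerivAt Φ Φ' 0 ∧ Φ 0 = u₀ ∧
          (∀ᶠ τ in 𝓝 0, R u₀ (Φ τ)) ∧ (T : Set F) ⊆ range Φ' := by
    intro T
    induction T using Finset.induction_on with
    | empty =>
      intro _
      exact ⟨ℝ, inferInstance, inferInstance, inferInstance, fun _ => u₀, 0,
        hasStrictFDerivAt_const _ _, rfl, Eventually.of_forall fun _ => hrefl _, by simp⟩
    | insert w T _ ih =>
      intro hT
      rw [Finset.coe_insert, insert_subset_iff] at hT
      obtain ⟨V, i1, i2, i3, Φ, Φ', hΦ, hΦ0, hreach, hrange⟩ := ih hT.2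
      obtain ⟨Y, hY, rfl⟩ := hT.1
      obtain ⟨O, hO, hRY⟩ := hR Y hY
      obtain ⟨φ, ε, hε, hφ, hφ'⟩ := exists_localFlow_hasStrictFDerivAt (h𝒴 Y hY) hO
      have hpair : HasStrictFDerivAt (fun p : ℝ × V => (p.1, Φ p.2))
          ((ContinuousLinearMap.fst ℝ ℝ V).prod (Φ'.comp (ContinuousLinearMap.snd ℝ ℝ V)))
          (0 : ℝ × V) :=
        hasStrictFDerivAt_fst.prodMk
          (HasStrictFDerivAt.comp (g := Φ) (0 : ℝ × V) hΦ hasStrictFDerivAt_snd)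
      have hφ'' : HasStrictFDerivAt (fun p : ℝ × F => φ p.2 p.1)
        (ContinuousLinearMap.snd ℝ ℝ F + (ContinuousLinearMap.fst ℝ ℝ F).smulRight (Y u₀))
        ((0 : ℝ × V).1, Φ (0 : ℝ × V).2) := by simpa [hΦ0] using hφ'
      refine ⟨ℝ × V, inferInstance, inferInstance, inferInstance, fun p => φ (Φ p.2) p.1, _,
        hφ''.comp (0 : ℝ × V) hpair, ?_, ?_, ?_⟩
      · simp [hΦ0, hφ.self_of_nhds.1]
      · have e1 : ∀ᶠ p : ℝ × V in 𝓝 0, p.1 ∈ Ioo (-ε) ε :=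
          continuousAt_fst.eventually_mem (Ioo_mem_nhds (by simpa) (by simpa))
        have e2 : ∀ᶠ p : ℝ × V in 𝓝 0, R u₀ (Φ p.2) :=
          (continuousAt_snd (X := ℝ) (Y := V) (p := 0)).eventually hreach
        have hΦc : Tendsto (fun p : ℝ × V => Φ p.2) (𝓝 0) (𝓝 u₀) := by
          have h1 : Tendsto Φ (𝓝 (0 : ℝ × V).2) (𝓝 u₀) := by
            simpa [hΦ0] using hΦ.continuousAt.tendsto
          exact h1.comp (continuousAt_snd (X := ℝ) (Y := V) (p := 0))
        filter_upwards [e1, e2, hΦc.eventually hφ] with p h1 h2 h3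
        refine htrans _ _ _ h2 ?_
        have := hRY (φ (Φ p.2)) ε hε h3.2 p.1 h1
        rwa [h3.1] at this
      · rw [Finset.coe_insert, insert_subset_iff]
        refine ⟨⟨(1, 0), by simp⟩, fun w hw => ?_⟩
        obtain ⟨v, rfl⟩ := hrange hw
        exact ⟨(0, v), by simp⟩
  obtain ⟨V, _, _, _, Φ, Φ', hΦ, hΦ0, hreach, hrange⟩ := key T hT
  have hsurj : Φ'.range = ⊤ := by
    rw [eq_top_iff, ← hspan, hTspan, Submodule.span_le]
    exact hrange
  have := hΦ.map_nhds_eq_of_surj hsurj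
  rw [hΦ0] at this
  rw [← this]
  exact hreach

/-! ### Flows and integral submanifolds -/

section LocalFields

variable {E : Type v} [NormedAddCommGroup E] [NormedSpace ℝ E]
variable {M : Type u} [TopologicalSpace M] [ChartedSpace E M]

/-- A slice of `S ⊆ M`: a smooth parametrization `j`, defined on an open set `O` of a Euclidean space,
of a part of `S` which is tangent to `D` and has a smooth left inverse `q` defined on an open subset
`U` of `M`. The values of `j` outside `O` and of `q` outside `U` are irrelevant. -/
structure Slice (D : ∀ x : M, Submodule ℝ (TangentSpace 𝓘(ℝ, E) x)) (S : Set M) (k : ℕ) where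
  O : Set (EuclideanSpace ℝ (Fin k))
  U : Set M
  j : EuclideanSpace ℝ (Fin k) → M
  q : M → EuclideanSpace ℝ (Fin k)
  isOpen_O : IsOpen O
  isOpen_U : IsOpen U
  contMDiffOn_j : ContMDiffOn (𝓡 k) 𝓘(ℝ, E) ∞ j O
  contMDiffOn_q : ContMDiffOn 𝓘(ℝ, E) (𝓡 k) ∞ q U
  mapsTo_j : MapsTo j O U
  q_j : ∀ u ∈ O, q (j u) = u
  j_mem : ∀ u ∈ O, j u ∈ S
  range_mfderiv_j : ∀ u ∈ O,
    LinearMap.range (mfderiv (𝓡 k) 𝓘(ℝ, E) j u).toLinearMap = D (j u)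

/-- An immersed integral manifold has a slice around each of its points `z`, with coordinates `φ`:
in the charts of the immersion, `i` is a linear inclusion, and `q` is the linear projection. -/
theorem exists_slice {D : ∀ x : M, Submodule ℝ (TangentSpace 𝓘(ℝ, E) x)} {k : ℕ} {N : Type u}
    [TopologicalSpace N] [ChartedSpace (EuclideanSpace ℝ (Fin k)) N] [IsManifold (𝓡 k) ∞ N]
    {i : N → M} (hi : Manifold.IsImmersion (𝓡 k) 𝓘(ℝ, E) ∞ i)
    (hD : ∀ z : N, LinearMap.range (mfderiv (𝓡 k) 𝓘(ℝ, E) i z).toLinearMap = D (i z)) (z : N) :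
    ∃ (s : Slice D (range i) k) (φ : N → EuclideanSpace ℝ (Fin k)),
      ContinuousAt φ z ∧ φ z ∈ s.O ∧ ∀ᶠ w in 𝓝 z, s.j (φ w) = i w := by
  have hic : ContMDiff (𝓡 k) 𝓘(ℝ, E) ∞ i := hi.contMDiff
  have h := hi.isImmersionOfComplement_complement z
  set φ := h.domChart with hφ
  set ψ := h.codChart with hψ
  set e := h.equiv with he
  have hφm := h.domChart_mem_maximalAtlas
  have hψm := h.codChart_mem_maximalAtlas
  have hwr : ∀ u ∈ φ.target, ψ (i (φ.symm u)) = e (u, 0) := by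
    intro u hu
    have hu' : u ∈ (h.domChart.extend (𝓡 k)).target := by simpa using hu
    have := h.writtenInCharts hu'
    simpa using this
  have hsrc : ∀ u ∈ φ.target, i (φ.symm u) ∈ ψ.source := fun u hu =>
    h.source_subset_preimage_source (φ.map_target hu)
  have hφs : ContMDiffOn (𝓡 k) (𝓡 k) ∞ φ.symm φ.target := contMDiffOn_symm_of_mem_maximalAtlas hφm
  have hL : ContMDiff 𝓘(ℝ, E) (𝓡 k) ∞ fun x : E => (e.symm x).1 :=
    ((ContinuousLinearMap.fst ℝ _ _).comp e.symm.toContinuousLinearMap).contDiff.contMDiff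
  refine ⟨⟨φ.target, ψ.source, i ∘ φ.symm, fun x => (e.symm (ψ x)).1, φ.open_target,
    ψ.open_source, hic.comp_contMDiffOn hφs,
    hL.comp_contMDiffOn (contMDiffOn_of_mem_maximalAtlas hψm), hsrc, fun u hu => ?_,
    fun u hu => mem_range_self _, fun u hu => ?_⟩, φ, ?_, ?_, ?_⟩
  · simp [hwr u hu]
  · have hw := φ.map_target hu
    have hd1 : MDifferentiableAt (𝓡 k) (𝓡 k) φ.symm u :=
      (hφs.contMDiffAt (φ.open_target.mem_nhds hu)).mdifferentiableAt (by simp)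
    have hd2 : MDifferentiableAt (𝓡 k) (𝓡 k) φ (φ.symm u) :=
      (contMDiffAt_of_mem_maximalAtlas hφm hw).mdifferentiableAt (by simp)
    have hd3 : MDifferentiableAt (𝓡 k) 𝓘(ℝ, E) i (φ.symm u) :=
      (hic _).mdifferentiableAt (by simp)
    have hsurj : Function.Surjective (mfderiv (𝓡 k) (𝓡 k) φ.symm u) := by
      intro w
      refine ⟨mfderiv (𝓡 k) (𝓡 k) φ (φ.symm u) w, ?_⟩
      have hu' : φ (φ.symm u) = u := φ.right_inv hu
      have h1 : mfderiv (𝓡 k) (𝓡 k) (φ.symm ∘ φ) (φ.symm u) w = w := by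
        have : (φ.symm ∘ φ) =ᶠ[𝓝 (φ.symm u)] id := by
          filter_upwards [φ.open_source.mem_nhds hw] with x hx
          exact φ.left_inv hx
        rw [this.mfderiv_eq, mfderiv_id]
        rfl
      rw [mfderiv_comp_apply_of_eq (y := u) (hy := hu') (hg := hd1) (hf := hd2)] at h1
      exact h1
    rw [mfderiv_comp u hd3 hd1]
    refine Eq.trans ?_ (hD (φ.symm u))
    ext w
    constructor
    · rintro ⟨v, rfl⟩
      exact ⟨_, rfl⟩
    · rintro ⟨v, rfl⟩
      obtain ⟨v, rfl⟩ := hsurj v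
      exact ⟨v, rfl⟩
  · exact φ.continuousAt h.mem_domChart_source
  · exact φ.map_source h.mem_domChart_source
  · filter_upwards [φ.open_source.mem_nhds h.mem_domChart_source] with w hw
    simp [φ.left_inv hw]

namespace Slice

variable {D : ∀ x : M, Submodule ℝ (TangentSpace 𝓘(ℝ, E) x)} {S : Set M} {k : ℕ}
  {s : Slice D S k} {u : EuclideanSpace ℝ (Fin k)}

theorem mdifferentiableAt_j (hu : u ∈ s.O) : MDifferentiableAt (𝓡 k) 𝓘(ℝ, E) s.j u :=
  (s.contMDiffOn_j.contMDiffAt (s.isOpen_O.mem_nhds hu)).mdifferentiableAt (by simp)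

theorem mfderiv_q_mfderiv_j (hu : u ∈ s.O) (w : EuclideanSpace ℝ (Fin k)) :
    mfderiv 𝓘(ℝ, E) (𝓡 k) s.q (s.j u) (mfderiv (𝓡 k) 𝓘(ℝ, E) s.j u w) = w := by
  have hq : MDifferentiableAt 𝓘(ℝ, E) (𝓡 k) s.q (s.j u) :=
    (s.contMDiffOn_q.contMDiffAt (s.isOpen_U.mem_nhds (s.mapsTo_j hu))).mdifferentiableAt
      (by simp)
  have h1 : s.q ∘ s.j =ᶠ[𝓝 u] id := by
    filter_upwards [s.isOpen_O.mem_nhds hu] with x hx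
    exact s.q_j x hx
  have h2 := mfderiv_comp_apply u hq (mdifferentiableAt_j hu) w
  rw [h1.mfderiv_eq, mfderiv_id] at h2
  exact h2.symm

end Slice

variable [IsManifold 𝓘(ℝ, E) ∞ M]

namespace LocalVectorField

variable (X : LocalVectorField E M)

theorem contMDiffAt {x : M} (hx : x ∈ X.dom) :
    ContMDiffAt 𝓘(ℝ, E) 𝓘(ℝ, E).tangent ∞
      (fun x => (⟨x, X.field x⟩ : TangentBundle 𝓘(ℝ, E) M)) x :=
  X.smooth.contMDiffAt (X.isOpen_dom.mem_nhds hx)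

theorem eventuallyEq_of_isMIntegralCurveAt [CompleteSpace E] {γ γ' : ℝ → M} {t₀ : ℝ}
    (hx : γ t₀ ∈ X.dom)
    (hγ : IsMIntegralCurveAt γ X.field t₀) (hγ' : IsMIntegralCurveAt γ' X.field t₀)
    (h : γ t₀ = γ' t₀) : γ =ᶠ[𝓝 t₀] γ' := by
  have : IsManifold 𝓘(ℝ, E) 1 M := IsManifold.of_le (n := ∞) (by simp)
  exact isMIntegralCurveAt_eventuallyEq_of_contMDiffAt_boundaryless
    ((X.contMDiffAt hx).of_le (by simp)) hγ hγ' h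

theorem eqOn_of_isMIntegralCurveOn [CompleteSpace E] [T2Space M] {γ γ' : ℝ → M} {a b t₀ : ℝ}
    (ht₀ : t₀ ∈ Ioo a b) (hdom : ∀ t ∈ Ioo a b, γ t ∈ X.dom)
    (hγ : IsMIntegralCurveOn γ X.field (Ioo a b)) (hγ' : IsMIntegralCurveOn γ' X.field (Ioo a b))
    (h : γ t₀ = γ' t₀) : EqOn γ γ' (Ioo a b) := by
  have hpre : PreconnectedSpace (Ioo a b) :=
    isPreconnected_iff_preconnectedSpace.1 isPreconnected_Ioo
  have hclopen : IsClopen {t : Ioo a b | γ t = γ' t} := by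
    refine ⟨isClosed_eq hγ.continuousOn.domRestrict hγ'.continuousOn.domRestrict, ?_⟩
    rw [isOpen_iff_mem_nhds]
    rintro ⟨t, ht⟩ (hteq : γ t = γ' t)
    have hmem := Ioo_mem_nhds ht.1 ht.2
    have := X.eventuallyEq_of_isMIntegralCurveAt (hdom t ht) (hγ.isMIntegralCurveAt hmem)
      (hγ'.isMIntegralCurveAt hmem) hteq
    exact (continuousAt_subtype_val (x := (⟨t, ht⟩ : Ioo a b))).eventually this
  have huniv := hclopen.eq_univ ⟨⟨t₀, ht₀⟩, h⟩
  intro t ht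
  have : (⟨t, ht⟩ : Ioo a b) ∈ {t : Ioo a b | γ t = γ' t} := huniv ▸ mem_univ _
  exact this

theorem FlowsTo.unique [CompleteSpace E] [T2Space M] {X : LocalVectorField E M} {t : ℝ} {x y y' : M}
    (h : X.FlowsTo t x y) (h' : X.FlowsTo t x y') : y = y' := by
  obtain ⟨γ, a, b, h0, ht, hdom, hγ, hγ0, rfl⟩ := h
  obtain ⟨γ', a', b', h0', ht', hdom', hγ', hγ0', rfl⟩ := h'
  have hsub : Ioo (max a a') (min b b') ⊆ Ioo a b :=
    Ioo_subset_Ioo (le_max_left _ _) (min_le_left _ _)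
  have hsub' : Ioo (max a a') (min b b') ⊆ Ioo a' b' :=
    Ioo_subset_Ioo (le_max_right _ _) (min_le_right _ _)
  exact X.eqOn_of_isMIntegralCurveOn (t₀ := 0)
    ⟨max_lt h0.1 h0'.1, lt_min h0.2 h0'.2⟩ (fun s hs => hdom s (hsub hs)) (hγ.mono hsub)
    (hγ'.mono hsub') (hγ0.trans hγ0'.symm) ⟨max_lt ht.1 ht'.1, lt_min ht.2 ht'.2⟩

theorem mem_flow_iff [CompleteSpace E] [T2Space M] {t : ℝ} {x y : M} :
    y ∈ X.flow t x ↔ X.FlowsTo t x y := by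
  constructor
  · rintro ⟨h, rfl⟩
    exact h.choose_spec
  · intro h
    exact ⟨⟨y, h⟩, (Exists.choose_spec (⟨y, h⟩ : ∃ y, X.FlowsTo t x y)).unique h⟩

theorem FlowsTo.symm {X : LocalVectorField E M} {t : ℝ} {x y : M} (h : X.FlowsTo t x y) :
    X.FlowsTo (-t) y x := by
  obtain ⟨γ, a, b, h0, ht, hdom, hγ, rfl, rfl⟩ := h
  refine ⟨γ ∘ (· + t), a - t, b - t, ⟨by linarith [ht.1], by linarith [ht.2]⟩,
    ⟨by linarith [h0.1], by linarith [h0.2]⟩, fun s hs => hdom _ ⟨?_, ?_⟩, ?_, by simp, by simp⟩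
  · linarith [hs.1]
  · linarith [hs.2]
  · refine (hγ.comp_add t).mono fun s hs => ?_
    exact ⟨by linarith [hs.1], by linarith [hs.2]⟩

end LocalVectorField

/-- `y` can be reached from `x` by finitely many flows of members of `𝒟`. -/
def Reachable (𝒟 : Set (LocalVectorField E M)) : M → M → Prop :=
  Relation.ReflTransGen fun x y => ∃ X ∈ 𝒟, ∃ t, X.FlowsTo t x y

theorem Reachable.symm {𝒟 : Set (LocalVectorField E M)} {x y : M} (h : Reachable 𝒟 x y) :
    Reachable 𝒟 y x := by
  induction h with
  | refl => exact .refl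
  | tail _ h ih =>
    obtain ⟨X, hX, t, h⟩ := h
    exact .head ⟨X, hX, -t, h.symm⟩ ih

namespace Slice

variable {D : ∀ x : M, Submodule ℝ (TangentSpace 𝓘(ℝ, E) x)} {S : Set M} {k : ℕ}
  (s : Slice D S k) (X : LocalVectorField E M)

/-- The vector field `X`, tangent to the slice, in the coordinates given by the slice. -/
def restrict (u : EuclideanSpace ℝ (Fin k)) : EuclideanSpace ℝ (Fin k) :=
  mfderiv 𝓘(ℝ, E) (𝓡 k) s.q (s.j u) (X.field (s.j u))

variable {s X} {u : EuclideanSpace ℝ (Fin k)}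

/-- A vector tangent to the slice is the image of its coordinate expression. -/
theorem mfderiv_j_restrict (hu : u ∈ s.O) (hX : X.field (s.j u) ∈ D (s.j u)) :
    mfderiv (𝓡 k) 𝓘(ℝ, E) s.j u (s.restrict X u) = X.field (s.j u) := by
  rw [← s.range_mfderiv_j u hu] at hX
  obtain ⟨w, hw⟩ := hX
  rw [restrict, ← hw]
  exact congrArg _ (mfderiv_q_mfderiv_j hu w)

theorem contDiffAt_restrict (hu : u ∈ s.O) (hX : s.j u ∈ X.dom) :
    ContDiffAt ℝ 1 (s.restrict X) u := by
  have hT := (s.contMDiffOn_q.contMDiffOn_tangentMapWithin (m := 1) (by norm_cast)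
    s.isOpen_U.uniqueMDiffOn)
  have hTat := hT.contMDiffAt (x := (⟨s.j u, X.field (s.j u)⟩ : TangentBundle 𝓘(ℝ, E) M))
    ((s.isOpen_U.preimage (FiberBundle.continuous_proj E _)).mem_nhds (s.mapsTo_j hu))
  have hXj := ((X.contMDiffAt hX).of_le (m := 1) (by simp)).comp u
    ((s.contMDiffOn_j.contMDiffAt (s.isOpen_O.mem_nhds hu)).of_le (by simp))
  have h := hTat.comp u hXj
  refine contMDiffAt_vectorSpace_iff_contDiffAt.1 ?_
  refine h.congr_of_eventuallyEq ?_
  filter_upwards [s.isOpen_O.mem_nhds hu] with x hx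
  simp only [tangentMapWithin, Function.comp_apply,
    mfderivWithin_of_isOpen s.isOpen_U (s.mapsTo_j hx)]
  exact Bundle.TotalSpace.ext (s.q_j x hx).symm HEq.rfl

theorem hasMFDerivAt_comp {c : ℝ → EuclideanSpace ℝ (Fin k)} {t : ℝ}
    (hc : HasDerivAt c (s.restrict X (c t)) t) (hu : c t ∈ s.O)
    (hX : X.field (s.j (c t)) ∈ D (s.j (c t))) :
    HasMFDerivAt 𝓘(ℝ, ℝ) 𝓘(ℝ, E) (s.j ∘ c) t
      ((1 : ℝ →L[ℝ] ℝ).smulRight (X.field ((s.j ∘ c) t))) := by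
  have h := HasMFDerivAt.comp t (mdifferentiableAt_j hu).hasMFDerivAt hc.hasFDerivAt.hasMFDerivAt
  refine h.congr_mfderiv (ContinuousLinearMap.ext fun (τ : ℝ) => ?_)
  change mfderiv (𝓡 k) 𝓘(ℝ, E) s.j (c t) (τ • s.restrict X (c t)) = τ • X.field (s.j (c t))
  rw [← mfderiv_j_restrict hu hX]
  exact map_smul _ _ _

theorem isMIntegralCurveOn_comp {c : ℝ → EuclideanSpace ℝ (Fin k)} {a b : ℝ}
    (hD : ∀ x ∈ X.dom, X.field x ∈ D x)
    (hc : ∀ t ∈ Ioo a b, HasDerivAt c (s.restrict X (c t)) t ∧ c t ∈ s.O ∩ s.j ⁻¹' X.dom) :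
    IsMIntegralCurveOn (s.j ∘ c) X.field (Ioo a b) := fun t ht =>
  (hasMFDerivAt_comp (hc t ht).1 (hc t ht).2.1 (hD _ (hc t ht).2.2)).hasMFDerivWithinAt

theorem inter_preimage_dom_mem_nhds (hu : u ∈ s.O) (hX : s.j u ∈ X.dom) :
    s.O ∩ s.j ⁻¹' X.dom ∈ 𝓝 u :=
  inter_mem (s.isOpen_O.mem_nhds hu)
    ((mdifferentiableAt_j hu).continuousAt.preimage_mem_nhds (X.isOpen_dom.mem_nhds hX))

/-- An integral curve of a field tangent to `D` does not leave the slice immediately: it agrees with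
the image of an integral curve of the restricted field. -/
theorem eventually_mem_of_isMIntegralCurveAt [CompleteSpace E]
    (hD : ∀ x ∈ X.dom, X.field x ∈ D x) (hu : u ∈ s.O) (hX : s.j u ∈ X.dom) {γ : ℝ → M} {t₀ : ℝ}
    (hγ : IsMIntegralCurveAt γ X.field t₀) (hγu : γ t₀ = s.j u) : ∀ᶠ t in 𝓝 t₀, γ t ∈ S := by
  obtain ⟨φ, ε, hε, hφ, -⟩ := exists_localFlow_hasStrictFDerivAt (contDiffAt_restrict hu hX)
    (inter_preimage_dom_mem_nhds hu hX)
  obtain ⟨h0, hc⟩ := hφ.self_of_nhds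
  have hint := (isMIntegralCurveOn_comp hD hc).comp_add (-t₀)
  have hnhds : Ioo (t₀ - ε) (t₀ + ε) ∈ 𝓝 t₀ := Ioo_mem_nhds (by linarith) (by linarith)
  have hshift : ∀ t ∈ Ioo (t₀ - ε) (t₀ + ε), t + -t₀ ∈ Ioo (-ε) ε := fun t ht =>
    ⟨by linarith [ht.1], by linarith [ht.2]⟩
  have heq := X.eventuallyEq_of_isMIntegralCurveAt (hγu ▸ hX) hγ
    (hint.isMIntegralCurveAt (mem_of_superset hnhds hshift)) (by simp [hγu, h0])
  filter_upwards [heq, hnhds] with t ht ht'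
  rw [ht]
  exact s.j_mem _ (hc _ (hshift t ht')).2.1

end Slice

theorem field_mem_spannedDistribution {𝒟 : Set (LocalVectorField E M)} {X : LocalVectorField E M}
    (hX : X ∈ 𝒟) {x : M} (hx : x ∈ X.dom) : X.field x ∈ spannedDistribution 𝒟 x :=
  Submodule.subset_span ⟨X, hX, hx, rfl⟩

/-- Near a point of a slice for the distribution spanned by `𝒟`, the restrictions of the members of
`𝒟` span the coordinate space, so their flows reach all nearby points. -/
theorem Slice.eventually_reachable {𝒟 : Set (LocalVectorField E M)} {S : Set M} {k : ℕ}
    {s : Slice (spannedDistribution 𝒟) S k} {u : EuclideanSpace ℝ (Fin k)} (hu : u ∈ s.O) :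
    ∀ᶠ u' in 𝓝 u, Reachable 𝒟 (s.j u) (s.j u') := by
  refine eventually_reachable_of_span_eq_top
    (𝒴 := {Y | ∃ X ∈ 𝒟, s.j u ∈ X.dom ∧ Y = s.restrict X})
    (R := fun u u' => Reachable 𝒟 (s.j u) (s.j u')) ?_ ?_ (fun _ => .refl)
    (fun _ _ _ h h' => h.trans h') ?_
  · rintro _ ⟨X, -, hX, rfl⟩
    exact contDiffAt_restrict hu hX
  · rw [eq_top_iff]
    intro w _
    have hw : mfderiv (𝓡 k) 𝓘(ℝ, E) s.j u w ∈ spannedDistribution 𝒟 (s.j u) :=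
      s.range_mfderiv_j u hu ▸ ⟨w, rfl⟩
    rw [← mfderiv_q_mfderiv_j hu w]
    refine Submodule.span_le (p := (Submodule.span ℝ _).comap
      (mfderiv 𝓘(ℝ, E) (𝓡 k) s.q (s.j u)).toLinearMap) |>.2 ?_ hw
    rintro _ ⟨X, hX, hx, rfl⟩
    exact Submodule.subset_span ⟨_, ⟨X, hX, hx, rfl⟩, rfl⟩
  · rintro _ ⟨X, hX, hx, rfl⟩
    refine ⟨_, inter_preimage_dom_mem_nhds hu hx, fun c ε hε hc t ht => .single ⟨X, hX, t, ?_⟩⟩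
    exact ⟨s.j ∘ c, -ε, ε, by simpa using hε, ht, fun t ht => (hc t ht).2.2,
      isMIntegralCurveOn_comp (fun x => field_mem_spannedDistribution hX) hc, rfl, rfl⟩

/-- The points of a connected integral submanifold of the distribution spanned by `𝒟` are reachable
from each other: reachability classes are open in the manifold topology. -/
theorem IsIntegralSubmanifold.reachable {𝒟 : Set (LocalVectorField E M)} {S : Set M}
    (hS : IsIntegralSubmanifold (spannedDistribution 𝒟) S) {x y : M} (hx : x ∈ S) (hy : y ∈ S) :
    Reachable 𝒟 x y := by
  obtain ⟨k, N, _, _, _, _, i, hi, -, rfl, hD⟩ := hS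
  have hloc : ∀ z : N, ∀ᶠ w in 𝓝 z, Reachable 𝒟 (i z) (i w) := by
    intro z
    obtain ⟨s, φ, hφ, hz, hj⟩ := exists_slice hi hD z
    have h := hφ.eventually (Slice.eventually_reachable hz)
    rw [hj.self_of_nhds] at h
    filter_upwards [h, hj] with w hw hw'
    rwa [hw'] at hw
  obtain ⟨z, rfl⟩ := hx
  obtain ⟨w, rfl⟩ := hy
  have hclopen : IsClopen {w | Reachable 𝒟 (i z) (i w)} := by
    refine ⟨⟨isOpen_iff_mem_nhds.2 fun w hw => ?_⟩, isOpen_iff_mem_nhds.2 fun w hw => ?_⟩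
    · filter_upwards [hloc w] with w' hw' hzw'
      exact hw (hzw'.trans hw'.symm)
    · filter_upwards [hloc w] with w' hw'
      exact hw.trans hw'
  exact eq_univ_iff_forall.1 (hclopen.eq_univ ⟨z, .refl⟩) w

/-- If integral submanifolds of `D` partition `M`, the integral curves of fields tangent to `D` stay
in one of them: the set of times spent in each member of the partition is open. -/
theorem LocalVectorField.FlowsTo.mem_of_partition [CompleteSpace E]
    {D : ∀ x : M, Submodule ℝ (TangentSpace 𝓘(ℝ, E) x)} {𝒮 : Set (Set M)}
    (hint : ∀ S ∈ 𝒮, IsIntegralSubmanifold D S) (hpart : Setoid.IsPartition 𝒮)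
    {X : LocalVectorField E M} (hX : ∀ x ∈ X.dom, X.field x ∈ D x) {t : ℝ} {x y : M}
    (h : X.FlowsTo t x y) {S : Set M} (hS : S ∈ 𝒮) (hx : x ∈ S) : y ∈ S := by
  obtain ⟨γ, a, b, h0, ht, hdom, hγ, rfl, rfl⟩ := h
  have hpre : PreconnectedSpace (Ioo a b) :=
    isPreconnected_iff_preconnectedSpace.1 isPreconnected_Ioo
  have hloc : ∀ τ ∈ Ioo a b, ∀ S ∈ 𝒮, γ τ ∈ S → ∀ᶠ τ' in 𝓝 τ, γ τ' ∈ S := by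
    intro τ hτ S hS hγS
    obtain ⟨k, N, _, _, _, _, i, hi, -, rfl, hD⟩ := hint S hS
    obtain ⟨z, hz⟩ := hγS
    obtain ⟨s, φ, -, hφz, hj⟩ := exists_slice hi hD z
    have hjz := hj.self_of_nhds
    exact s.eventually_mem_of_isMIntegralCurveAt hX hφz (by rw [hjz, hz]; exact hdom τ hτ)
      (hγ.isMIntegralCurveAt (Ioo_mem_nhds hτ.1 hτ.2)) (by rw [hjz, hz])
  have hclopen : IsClopen {τ : Ioo a b | γ τ ∈ S} := by
    refine ⟨⟨isOpen_iff_mem_nhds.2 fun τ hτ => ?_⟩, isOpen_iff_mem_nhds.2 fun τ hτ => ?_⟩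
    · obtain ⟨S', ⟨hS', hτS'⟩, -⟩ := hpart.2 (γ τ)
      filter_upwards [continuousAt_subtype_val.eventually (hloc τ τ.2 S' hS' hτS')] with σ hσ hσS
      rw [(hpart.2 (γ σ)).unique ⟨hS', hσ⟩ ⟨hS, hσS⟩] at hτS'
      exact hτ hτS'
    · exact continuousAt_subtype_val.eventually (hloc τ τ.2 S hS hτ)
  exact eq_univ_iff_forall.1 (hclopen.eq_univ ⟨⟨0, h0⟩, hx⟩) ⟨t, ht⟩

end LocalFields

/-! ### Smooth functions and tangent vectors -/

section BumpFunctions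

variable {E : Type v} [NormedAddCommGroup E] [NormedSpace ℝ E] [FiniteDimensional ℝ E]
variable {M : Type u} [TopologicalSpace M] [ChartedSpace E M] [IsManifold 𝓘(ℝ, E) ∞ M] [T2Space M]

/-- Every germ of a smooth function on `M` extends to a global smooth function. -/
theorem exists_contMDiff_eventuallyEq {V : Type*} [NormedAddCommGroup V] [NormedSpace ℝ V]
    {U : Set M} (hU : IsOpen U) {f : M → V} (hf : ContMDiffOn 𝓘(ℝ, E) 𝓘(ℝ, V) ∞ f U) {x : M}
    (hx : x ∈ U) :
    ∃ F : M → V, ContMDiff 𝓘(ℝ, E) 𝓘(ℝ, V) ∞ F ∧ F =ᶠ[𝓝 x] f := by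
  obtain ⟨ρ, -, hρ⟩ :=
    (SmoothBumpFunction.nhds_basis_tsupport (I := 𝓘(ℝ, E)) x).mem_iff.1 (hU.mem_nhds hx)
  refine ⟨fun y => ρ y • f y, contMDiff_of_tsupport fun y hy => ?_, ?_⟩
  · have hyU : y ∈ U := hρ (tsupport_smul_subset_left _ _ hy)
    exact ρ.contMDiffAt.smul (hf.contMDiffAt (hU.mem_nhds hyU))
  · filter_upwards [ρ.eventuallyEq_one] with y hy
    simp [hy]

/-- A tangent vector is determined by the derivatives of the global smooth functions. -/
theorem tangentVector_ext {x : M} {v w : TangentSpace 𝓘(ℝ, E) x}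
    (h : ∀ g : SmoothFun E M, (mfderiv 𝓘(ℝ, E) 𝓘(ℝ, ℝ) (g : M → ℝ) x v : ℝ)
      = mfderiv 𝓘(ℝ, E) 𝓘(ℝ, ℝ) (g : M → ℝ) x w) : v = w := by
  obtain ⟨G, hG, hGe⟩ := exists_contMDiff_eventuallyEq (chartAt E x).open_source
    (contMDiffOn_extChartAt (I := 𝓘(ℝ, E)) (n := ∞) (x := x)) (mem_chart_source E x)
  have hinj : Function.Injective (mfderiv 𝓘(ℝ, E) 𝓘(ℝ, E) G x) := by
    have : IsManifold 𝓘(ℝ, E) 1 M := IsManifold.of_le (n := ∞) (by simp)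
    rw [hGe.mfderiv_eq]
    exact (isInvertible_mfderiv_extChartAt (mem_extChartAt_source x)).injective
  refine hinj ((SeparatingDual.eq_iff_forall_dual_eq (R := ℝ) (V := E)).2 fun ℓ => ?_)
  have hg : ContMDiff 𝓘(ℝ, E) 𝓘(ℝ, ℝ) ∞ (ℓ ∘ G) := ℓ.contDiff.contMDiff.comp hG
  have key : ∀ v : TangentSpace 𝓘(ℝ, E) x, (mfderiv 𝓘(ℝ, E) 𝓘(ℝ, ℝ) (ℓ ∘ G) x v : ℝ)
      = ℓ (mfderiv 𝓘(ℝ, E) 𝓘(ℝ, E) G x v) := by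
    intro v
    rw [mfderiv_comp_apply x (ℓ.contDiff.contMDiff.mdifferentiable (n := ∞) (by simp) _)
      (hG.mdifferentiable (by simp) x), ContinuousLinearMap.mfderiv_eq]
    rfl
  have := h ⟨_, hg⟩
  exact (key v).symm.trans (this.trans (key w))

end BumpFunctions

/-! ### Compositions of partial maps -/

section Pseudogroup

variable {α : Type*}

theorem mem_composeList_nil {x y : α} : y ∈ composeList ([] : List (α →. α)) x ↔ y = x := by
  exact Part.mem_some_iff

theorem mem_composeList_cons {G : α →. α} {L : List (α →. α)} {x z : α} :
    z ∈ composeList (G :: L) x ↔ ∃ y ∈ composeList L x, z ∈ G y := by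
  exact Part.mem_bind_iff

theorem reflTransGen_iff_exists_composeList {𝒢 : Set (α →. α)} {x y : α} :
    Relation.ReflTransGen (fun x y => ∃ G ∈ 𝒢, y ∈ G x) x y ↔
      ∃ L : List (α →. α), (∀ G ∈ L, G ∈ 𝒢) ∧ y ∈ composeList L x := by
  constructor
  · intro h
    induction h with
    | refl => exact ⟨[], by simp, mem_composeList_nil.2 rfl⟩
    | tail _ h ih =>
      obtain ⟨G, hG, h⟩ := h
      obtain ⟨L, hL, hy⟩ := ih
      exact ⟨G :: L, List.forall_mem_cons.2 ⟨hG, hL⟩, mem_composeList_cons.2 ⟨_, hy, h⟩⟩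
  · rintro ⟨L, hL, hy⟩
    induction L generalizing y with
    | nil => rw [mem_composeList_nil.1 hy]
    | cons G L ih =>
      obtain ⟨hG, hL⟩ := List.forall_mem_cons.1 hL
      obtain ⟨w, hw, hy⟩ := mem_composeList_cons.1 hy
      exact (ih hL hw).tail ⟨G, hG, hy⟩

end Pseudogroup

/-! ### Equivariance of the flows of the polar family -/

section Poisson

variable {E : Type v} [NormedAddCommGroup E] [NormedSpace ℝ E] [FiniteDimensional ℝ E]
variable {M : Type u} [TopologicalSpace M] [ChartedSpace E M] [IsManifold 𝓘(ℝ, E) ∞ M] [T2Space M]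

theorem exists_mem_generatedPseudogroup_iff {𝒟 : Set (LocalVectorField E M)} {x y : M} :
    (∃ F ∈ generatedPseudogroup 𝒟, y ∈ F x) ↔ Reachable 𝒟 x y := by
  have := FiniteDimensional.complete ℝ E
  have h : (fun x y : M => ∃ X ∈ 𝒟, ∃ t, X.FlowsTo t x y) =
      fun x y => ∃ G ∈ {G : M →. M | ∃ X ∈ 𝒟, ∃ t : ℝ, G = X.flow t}, y ∈ G x := by
    ext x y
    constructor
    · rintro ⟨X, hX, t, h⟩
      exact ⟨_, ⟨X, hX, t, rfl⟩, X.mem_flow_iff.2 h⟩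
    · rintro ⟨_, ⟨X, hX, t, rfl⟩, h⟩
      exact ⟨X, hX, t, X.mem_flow_iff.1 h⟩
  rw [Reachable, h, reflTransGen_iff_exists_composeList]
  constructor
  · rintro ⟨_, ⟨L, hL, rfl⟩, hy⟩
    exact ⟨L, hL, hy⟩
  · rintro ⟨L, hL, hy⟩
    exact ⟨_, ⟨L, hL, rfl⟩, hy⟩

variable {P : PoissonStructure E M} {A : Subgroup P.aut}

/-- The members of the polar family of `A` are `A`-invariant vector fields. -/
theorem field_smul_of_mem_polarFamily {X : LocalVectorField E M} (hX : X ∈ polarFamily P A)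
    (a : A) {x : M} (hx : x ∈ X.dom) :
    X.field (a • x) = mfderiv 𝓘(ℝ, E) 𝓘(ℝ, E) ((a : P.aut) : Diff E M) x (X.field x) := by
  obtain ⟨hdom, f, hf, hinv, hham⟩ := hX
  set φ : Diff E M := ((a : P.aut) : Diff E M) with hφ
  have hax : φ x ∈ X.dom := hdom a x hx
  obtain ⟨F, hF, hFf⟩ := exists_contMDiff_eventuallyEq X.isOpen_dom hf hax
  let F' : SmoothFun E M := ⟨F, hF⟩
  -- By invariance of `f`, the pullback of a germ of `f` at `a • x` is a germ of `f` at `x`.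
  have hFx : (F'.comp φ.toContMDiffMap : M → ℝ) =ᶠ[𝓝 x] f := by
    filter_upwards [φ.continuous.continuousAt.eventually hFf, X.isOpen_dom.mem_nhds hx]
      with y hy hyd
    exact hy.trans (hinv a y hyd)
  refine tangentVector_ext fun g => ?_
  have h1 := hham _ hax F' g hFf
  have h2 := hham x hx _ (g.comp φ.toContMDiffMap) hFx
  rw [(a : P.aut).2] at h2
  refine h1.trans (h2.symm.trans ?_)
  exact mfderiv_comp_apply x (g.contMDiff.mdifferentiable (by simp) _)
    (φ.contMDiff.mdifferentiable (by simp) x) _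

theorem LocalVectorField.FlowsTo.smul {X : LocalVectorField E M} (hX : X ∈ polarFamily P A)
    (a : A) {t : ℝ} {x y : M} (h : X.FlowsTo t x y) : X.FlowsTo t (a • x) (a • y) := by
  obtain ⟨γ, c, d, h0, ht, hdom, hγ, rfl, rfl⟩ := h
  refine ⟨fun s => a • γ s, c, d, h0, ht, fun s hs => hX.1 a _ (hdom s hs), fun s hs => ?_,
    rfl, rfl⟩
  have hφ : MDifferentiableAt 𝓘(ℝ, E) 𝓘(ℝ, E) ((a : P.aut) : Diff E M) (γ s) :=
    ((a : P.aut) : Diff E M).contMDiff.mdifferentiable (by simp) _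
  refine (hφ.hasMFDerivAt.comp_hasMFDerivWithinAt s (hγ s hs)).congr_mfderiv
    (ContinuousLinearMap.ext fun (τ : ℝ) => ?_)
  change mfderiv 𝓘(ℝ, E) 𝓘(ℝ, E) ((a : P.aut) : Diff E M) (γ s) (τ • X.field (γ s))
    = τ • X.field (a • γ s)
  rw [field_smul_of_mem_polarFamily hX a (hdom s hs)]
  exact map_smul _ _ _

end Poisson

/-! ### The orbit space and its symplectic leaves -/

section Quotient

variable {E : Type v} [NormedAddCommGroup E] [NormedSpace ℝ E]
variable {M : Type u} [TopologicalSpace M] [ChartedSpace E M]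
variable {P : PoissonStructure E M} {A B : Subgroup P.aut}

theorem proj_eq_proj_iff {x y : M} : proj P A x = proj P A y ↔ ∃ a : A, a • y = x := by
  rw [proj, proj, Quotient.eq, MulAction.orbitRel_apply, MulAction.mem_orbit_iff]

theorem proj_smul (a : A) (x : M) : proj P A (a • x) = proj P A x :=
  proj_eq_proj_iff.2 ⟨a, rfl⟩

theorem isOpenMap_proj : IsOpenMap (proj P A) := by
  have : ContinuousConstSMul A M := ⟨fun a => ((a : P.aut) : Diff E M).continuous⟩
  exact isOpenMap_quotient_mk'_mul

theorem continuous_proj : Continuous (proj P A) := continuous_quotient_mk'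

/-- The graph of an induced partial map is the projection of the graph of the original one. -/
theorem Induces.mem_iff {F : M →. M} {Fbar : OrbitSpace P A →. OrbitSpace P A}
    (h : Induces P A F Fbar) {p q : OrbitSpace P A} :
    q ∈ Fbar p ↔ ∃ x y, y ∈ F x ∧ proj P A x = p ∧ proj P A y = q := by
  constructor
  · intro hq
    have hp : p ∈ proj P A '' F.Dom := h.1 ▸ (PFun.mem_dom _ _).2 ⟨q, hq⟩
    obtain ⟨x, hx, rfl⟩ := hp
    obtain ⟨y, hy⟩ := (PFun.mem_dom _ _).1 hx
    exact ⟨x, y, hy, rfl, Part.mem_unique (h.2 x y hy) hq⟩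
  · rintro ⟨x, y, hy, rfl, rfl⟩
    exact h.2 x y hy

/-- A partial map of `M` commuting with `A` induces a unique partial map of `M/A`. -/
theorem existsUnique_induces {F : M →. M}
    (hF : ∀ (a : A) (x y : M), y ∈ F x → a • y ∈ F (a • x)) : ∃! Fbar, Induces P A F Fbar := by
  refine existsUnique_of_exists_of_unique ?_ fun G G' hG hG' =>
    PFun.ext fun p q => hG.mem_iff.trans hG'.mem_iff.symm
  have hex : ∀ p ∈ proj P A '' F.Dom, ∃ q, ∃ x y, y ∈ F x ∧ proj P A x = p ∧ proj P A y = q := by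
    rintro _ ⟨x, hx, rfl⟩
    obtain ⟨y, hy⟩ := (PFun.mem_dom _ _).1 hx
    exact ⟨_, x, y, hy, rfl, rfl⟩
  choose g hg using hex
  refine ⟨fun p => ⟨p ∈ proj P A '' F.Dom, g p⟩, rfl, fun x y hy => ?_⟩
  have hx : proj P A x ∈ proj P A '' F.Dom := ⟨x, (PFun.mem_dom _ _).2 ⟨y, hy⟩, rfl⟩
  refine ⟨hx, ?_⟩
  obtain ⟨x', y', hy', hxx', hg'⟩ := hg _ hx
  obtain ⟨a, rfl⟩ := proj_eq_proj_iff.1 hxx'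
  rw [Part.mem_unique hy' (hF a x y hy), proj_smul] at hg'
  exact hg'.symm

theorem isPartition_range_orbit : Setoid.IsPartition (range fun m : M => MulAction.orbit B m) := by
  refine ⟨?_, fun m => ⟨_, ⟨⟨m, rfl⟩, MulAction.mem_orbit_self m⟩, ?_⟩⟩
  · rintro ⟨m, hm⟩
    exact (hm ▸ MulAction.mem_orbit_self m : m ∈ (∅ : Set M))
  · rintro _ ⟨⟨m', rfl⟩, hm⟩
    exact (MulAction.orbit_eq_iff.2 hm).symm

variable [IsManifold 𝓘(ℝ, E) ∞ M]

theorem IsDualPair.symm (h : IsDualPair P A B) : IsDualPair P B A :=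
  ⟨h.integrable_right, h.integrable_left, h.leaves_right, h.leaves_left⟩

theorem IsDualPair.isIntegralSubmanifold_orbit (h : IsDualPair P A B) (m : M) :
    IsIntegralSubmanifold (polarDistribution P A) (MulAction.orbit B m) := by
  have : MulAction.orbit B m ∈ {S | IsLeaf (polarDistribution P A) S} :=
    h.leaves_left ▸ mem_range_self m
  exact this.1

/-- The Hamiltonian flows of `M/A` are the partial maps induced by the flows of the polar family:
an invariant function on an invariant open set is the pullback of a function on the orbit space. -/
theorem mem_hamiltonianFlows_iff {Fbar : OrbitSpace P A →. OrbitSpace P A} :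
    Fbar ∈ hamiltonianFlows P A ↔
      ∃ X ∈ polarFamily P A, ∃ t, Induces P A (X.flow t) Fbar := by
  constructor
  · rintro ⟨V, h, X, t, -, -, hsmooth, hdom, hham, hind⟩
    refine ⟨X, ⟨fun a x hx => ?_, h ∘ proj P A, hdom ▸ hsmooth, fun a x _ => ?_, hham⟩, t, hind⟩
    · rw [hdom] at hx ⊢
      rwa [mem_preimage, proj_smul]
    · exact congrArg h (proj_smul a x)
  · rintro ⟨X, ⟨hinv, f, hf, hfinv, hham⟩, t, hind⟩
    have hdom : X.dom = proj P A ⁻¹' (proj P A '' X.dom) := by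
      refine (subset_preimage_image _ _).antisymm ?_
      rintro x ⟨y, hy, hxy⟩
      obtain ⟨a, rfl⟩ := proj_eq_proj_iff.1 hxy.symm
      exact hinv a y hy
    let h : OrbitSpace P A → ℝ := fun p => f p.out
    have hh : EqOn (h ∘ proj P A) f X.dom := by
      intro x hx
      obtain ⟨a, ha⟩ := proj_eq_proj_iff.1 (Quotient.out_eq (proj P A x) :
        proj P A (proj P A x).out = proj P A x)
      change f (proj P A x).out = f x
      rw [← ha, hfinv a x hx]
    have hopen : IsOpen (proj P A '' X.dom) := isOpenMap_proj _ X.isOpen_dom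
    have hsmooth : ContMDiffOn 𝓘(ℝ, E) 𝓘(ℝ, ℝ) ∞ (h ∘ proj P A) X.dom := hf.congr hh
    refine ⟨_, h, X, t, hopen, ?_, hdom ▸ hsmooth, hdom, fun x hx F g hF => ?_, hind⟩
    · rintro _ ⟨x, hx, rfl⟩
      refine ContinuousAt.continuousWithinAt ?_
      have hc : ContinuousAt (h ∘ proj P A) x :=
        hsmooth.continuousOn.continuousAt (X.isOpen_dom.mem_nhds hx)
      -- `proj` is open and continuous, so continuity of `h` can be tested on `M`.
      rw [ContinuousAt, ← isOpenMap_proj.map_nhds_eq continuous_proj.continuousAt]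
      exact hc
    · exact hham x hx F g (hF.trans (hh.eventuallyEq_of_mem (X.isOpen_dom.mem_nhds hx)))

variable [FiniteDimensional ℝ E]

/-- In a dual pair, the flows of the polar family of `A` preserve the `B`-orbits. -/
theorem IsDualPair.reachable_mem_orbit (h : IsDualPair P A B) {x y : M}
    (hxy : Reachable (polarFamily P A) x y) : y ∈ MulAction.orbit B x := by
  have := FiniteDimensional.complete ℝ E
  induction hxy with
  | refl => exact MulAction.mem_orbit_self x
  | tail _ hyz ih =>
    obtain ⟨X, hX, t, hyz⟩ := hyz
    exact hyz.mem_of_partition (D := polarDistribution P A)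
      (forall_mem_range.2 h.isIntegralSubmanifold_orbit) isPartition_range_orbit
      (fun _ => field_mem_spannedDistribution hX) (mem_range_self x) ih

variable [T2Space M]

theorem smul_mem_flow {X : LocalVectorField E M} (hX : X ∈ polarFamily P A) (t : ℝ) (a : A)
    {x y : M} (h : y ∈ X.flow t x) : a • y ∈ X.flow t (a • x) := by
  have := FiniteDimensional.complete ℝ E
  exact X.mem_flow_iff.2 ((X.mem_flow_iff.1 h).smul hX a)

theorem smul_mem_of_mem_polarPseudogroup {F : M →. M} (hF : F ∈ polarPseudogroup P A) (a : A)
    {x y : M} (h : y ∈ F x) : a • y ∈ F (a • x) := by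
  obtain ⟨L, hL, rfl⟩ := hF
  induction L generalizing y with
  | nil => rw [mem_composeList_nil] at h ⊢; rw [h]
  | cons G L ih =>
    obtain ⟨⟨X, hX, t, rfl⟩, hL'⟩ := List.forall_mem_cons.1 hL
    obtain ⟨w, hw, hy⟩ := mem_composeList_cons.1 h
    exact mem_composeList_cons.2 ⟨_, ih hL' hw, smul_mem_flow hX t a hy⟩

theorem existsUnique_induces_of_mem_polarPseudogroup {F : M →. M}
    (hF : F ∈ polarPseudogroup P A) : ∃! Fbar, Induces P A F Fbar :=
  existsUnique_induces fun a _ _ h => smul_mem_of_mem_polarPseudogroup hF a h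

theorem Reachable.smul {x y : M} (h : Reachable (polarFamily P A) x y) (a : A) :
    Reachable (polarFamily P A) (a • x) (a • y) := by
  induction h with
  | refl => exact .refl
  | tail _ h ih =>
    obtain ⟨X, hX, t, h⟩ := h
    exact ih.tail ⟨X, hX, t, h.smul hX a⟩

/-- The orbits of the polar pseudogroup on `M/A` are the projections of the reachability classes of
the polar family. -/
theorem mem_polarOrbit_iff {p q : OrbitSpace P A} :
    q ∈ polarOrbit P A p ↔
      ∃ x y, Reachable (polarFamily P A) x y ∧ proj P A x = p ∧ proj P A y = q := by
  constructor
  · rintro ⟨F, hF, Fbar, hind, hq⟩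
    obtain ⟨x, y, hy, hx, hyq⟩ := hind.mem_iff.1 hq
    exact ⟨x, y, exists_mem_generatedPseudogroup_iff.1 ⟨F, hF, hy⟩, hx, hyq⟩
  · rintro ⟨x, y, h, hx, hy⟩
    obtain ⟨F, hF, hyF⟩ := exists_mem_generatedPseudogroup_iff.2 h
    obtain ⟨Fbar, hind, -⟩ := existsUnique_induces_of_mem_polarPseudogroup hF
    exact ⟨F, hF, Fbar, hind, hind.mem_iff.2 ⟨x, y, hyF, hx, hy⟩⟩

/-- The symplectic leaves are the projections of the reachability classes of the polar family. A chain
of Hamiltonian flows lifts to `M`, since by equivariance each flow may be moved along `A` to start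
where the previous one ends. -/
theorem mem_symplecticLeaf_iff {p q : OrbitSpace P A} :
    q ∈ symplecticLeaf P A p ↔
      ∃ x y, Reachable (polarFamily P A) x y ∧ proj P A x = p ∧ proj P A y = q := by
  have := FiniteDimensional.complete ℝ E
  refine reflTransGen_iff_exists_composeList.symm.trans ⟨fun h => ?_, ?_⟩
  · induction h with
    | refl =>
      obtain ⟨x, rfl⟩ := Quotient.exists_rep p
      exact ⟨x, x, .refl, rfl, rfl⟩
    | tail _ h ih =>
      obtain ⟨G, hG, h⟩ := h
      obtain ⟨X, hX, t, hind⟩ := mem_hamiltonianFlows_iff.1 hG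
      obtain ⟨y', z, hz, hy', rfl⟩ := hind.mem_iff.1 h
      obtain ⟨x, y, hxy, rfl, hy⟩ := ih
      obtain ⟨a, rfl⟩ := proj_eq_proj_iff.1 (hy.trans hy'.symm)
      exact ⟨x, a • z, hxy.tail ⟨X, hX, t, (X.mem_flow_iff.1 hz).smul hX a⟩, rfl, proj_smul a z⟩
  · rintro ⟨x, y, h, rfl, rfl⟩
    induction h with
    | refl => exact .refl
    | tail _ h ih =>
      obtain ⟨X, hX, t, h⟩ := h
      obtain ⟨G, hind, -⟩ := existsUnique_induces (P := P) (A := A) fun a _ _ h =>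
        smul_mem_flow hX t a h
      exact ih.tail ⟨G, mem_hamiltonianFlows_iff.2 ⟨X, hX, t, hind⟩,
        hind.2 _ _ (X.mem_flow_iff.2 h)⟩

theorem proj_mem_symplecticLeaf_iff {m : M} {q : OrbitSpace P A} :
    q ∈ symplecticLeaf P A (proj P A m) ↔
      ∃ y, Reachable (polarFamily P A) m y ∧ proj P A y = q := by
  rw [mem_symplecticLeaf_iff]
  constructor
  · rintro ⟨x, y, h, hx, rfl⟩
    obtain ⟨a, rfl⟩ := proj_eq_proj_iff.1 hx.symm
    exact ⟨a • y, h.smul a, proj_smul a y⟩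
  · rintro ⟨y, h, rfl⟩
    exact ⟨m, y, h, rfl, rfl⟩

theorem symplecticLeaf_eq_polarOrbit (p : OrbitSpace P A) :
    symplecticLeaf P A p = polarOrbit P A p :=
  Set.ext fun _ => mem_symplecticLeaf_iff.trans mem_polarOrbit_iff.symm

theorem leafSpace_eq_polarOrbitSpace : leafSpace P A = polarOrbitSpace P A :=
  congrArg range (funext symplecticLeaf_eq_polarOrbit)

theorem equivalence_symplecticLeaf : Equivalence (fun p q => q ∈ symplecticLeaf P A p) where
  refl p := by
    obtain ⟨x, rfl⟩ := Quotient.exists_rep p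
    exact mem_symplecticLeaf_iff.2 ⟨x, x, .refl, rfl, rfl⟩
  symm h := by
    obtain ⟨x, y, h, hx, hy⟩ := mem_symplecticLeaf_iff.1 h
    exact mem_symplecticLeaf_iff.2 ⟨y, x, h.symm, hy, hx⟩
  trans h h' := by
    obtain ⟨x, y, hxy, rfl, rfl⟩ := mem_symplecticLeaf_iff.1 h
    obtain ⟨z, hyz, rfl⟩ := proj_mem_symplecticLeaf_iff.1 h'
    exact mem_symplecticLeaf_iff.2 ⟨x, z, hxy.trans hyz, rfl, rfl⟩

theorem symplecticLeaf_eq_iff {p q : OrbitSpace P A} :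
    symplecticLeaf P A p = symplecticLeaf P A q ↔ q ∈ symplecticLeaf P A p := by
  have e := equivalence_symplecticLeaf (P := P) (A := A)
  exact ⟨fun h => h ▸ e.refl q, fun h => Set.ext fun r => ⟨e.trans (e.symm h), e.trans h⟩⟩

/-- In a dual pair, points lying over the same symplectic leaf of `M/A` lie over the same symplectic
leaf of `M/B`. -/
theorem IsDualPair.proj_mem_symplecticLeaf (h : IsDualPair P A B) {m m' : M}
    (hm : proj P A m' ∈ symplecticLeaf P A (proj P A m)) :
    proj P B m' ∈ symplecticLeaf P B (proj P B m) := by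
  obtain ⟨y, hmy, hy⟩ := proj_mem_symplecticLeaf_iff.1 hm
  obtain ⟨b, rfl⟩ := h.reachable_mem_orbit hmy
  -- `m'` is in the `A`-orbit of `b • m`, an integral submanifold of the polar distribution of `B`.
  refine mem_symplecticLeaf_iff.2 ⟨b • m, m', ?_, proj_smul b m, rfl⟩
  exact (h.symm.isIntegralSubmanifold_orbit (b • m)).reachable
    (MulAction.mem_orbit_self _) (proj_eq_proj_iff.1 hy.symm)

theorem IsDualPair.exists_bijective (h : IsDualPair P A B) :
    ∃ Φ : leafSpace P A → leafSpace P B, Function.Bijective Φ ∧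
      ∀ m : M, Φ ⟨symplecticLeaf P A (proj P A m), mem_range_self _⟩
        = ⟨symplecticLeaf P B (proj P B m), mem_range_self _⟩ := by
  have hiff : ∀ m m' : M,
      symplecticLeaf P A (proj P A m) = symplecticLeaf P A (proj P A m') ↔
        symplecticLeaf P B (proj P B m) = symplecticLeaf P B (proj P B m') := fun m m' => by
    rw [symplecticLeaf_eq_iff, symplecticLeaf_eq_iff]
    exact ⟨h.proj_mem_symplecticLeaf, h.symm.proj_mem_symplecticLeaf⟩
  have hrep : ∀ L : leafSpace P A, ∃ m : M, L.1 = symplecticLeaf P A (proj P A m) := by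
    rintro ⟨_, p, rfl⟩
    obtain ⟨m, rfl⟩ := Quotient.exists_rep p
    exact ⟨m, rfl⟩
  choose r hr using hrep
  have hΦ : ∀ m : M, symplecticLeaf P B (proj P B (r ⟨symplecticLeaf P A (proj P A m),
      mem_range_self _⟩)) = symplecticLeaf P B (proj P B m) := fun m =>
    (hiff _ _).1 (hr _).symm
  refine ⟨fun L => ⟨symplecticLeaf P B (proj P B (r L)), mem_range_self _⟩, ⟨?_, ?_⟩, fun m =>
    Subtype.ext (hΦ m)⟩
  · intro L L' hLL'
    exact Subtype.ext ((hr L).trans (((hiff _ _).2 (congrArg Subtype.val hLL')).trans (hr L').symm))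
  · rintro ⟨_, p, rfl⟩
    obtain ⟨m, rfl⟩ := Quotient.exists_rep p
    exact ⟨⟨symplecticLeaf P A (proj P A m), mem_range_self _⟩, Subtype.ext (hΦ m)⟩

end Quotient

end SingularDual

end

open SingularDual in
theorem theorem4p5 {E : Type*} [NormedAddCommGroup E] [NormedSpace ℝ E] [FiniteDimensional ℝ E]
    {M : Type*} [TopologicalSpace M] [ChartedSpace E M] [IsManifold 𝓘(ℝ, E) ∞ M]
    [T2Space M] [SecondCountableTopology M]
    (P : PoissonStructure E M) (A B : Subgroup P.aut) :
    -- the standard polar pseudogroups act on the quotients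
    ((∀ F ∈ polarPseudogroup P A, ∃! Fbar, Induces P A F Fbar) ∧
      (∀ F ∈ polarPseudogroup P B, ∃! Fbar, Induces P B F Fbar)) ∧
    -- lying in the same symplectic leaf is an equivalence relation
    (Equivalence (fun p q => q ∈ symplecticLeaf P A p) ∧
      Equivalence (fun p q => q ∈ symplecticLeaf P B p)) ∧
    -- the symplectic leaves are the orbits of the standard polar pseudogroups
    ((∀ p, symplecticLeaf P A p = polarOrbit P A p) ∧
      (∀ p, symplecticLeaf P B p = polarOrbit P B p) ∧
      leafSpace P A = polarOrbitSpace P A ∧ leafSpace P B = polarOrbitSpace P B) ∧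
    -- symplectic leaf correspondence
    (IsDualPair P A B →
      ∃ Φ : leafSpace P A → leafSpace P B, Function.Bijective Φ ∧
        ∀ m : M, Φ ⟨symplecticLeaf P A (proj P A m), mem_range_self _⟩
          = ⟨symplecticLeaf P B (proj P B m), mem_range_self _⟩) :=
  ⟨⟨fun _ => existsUnique_induces_of_mem_polarPseudogroup,
      fun _ => existsUnique_induces_of_mem_polarPseudogroup⟩,
    ⟨equivalence_symplecticLeaf, equivalence_symplecticLeaf⟩,
    ⟨symplecticLeaf_eq_polarOrbit, symplecticLeaf_eq_polarOrbit, leafSpace_eq_polarOrbitSpace,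
      leafSpace_eq_polarOrbitSpace⟩,
    IsDualPair.exists_bijective⟩
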